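/- Let $A$ be a (not necessarily unital) $C^*$-algebra with positive cone $A_+$. By an ideal of $A$ we mean a two-sided ring ideal: an additive subgroup closed under left and right multiplication by elements of $A$, not assumed to be norm-closed, self-adjoint, or closed under multiplication by scalars. For an ideal $L$ put $L_+ := L \cap A_+$. An ideal $L$ is a Dixmier ideal if it is the complex linear span of $L_+$, if $0 \le a \le b$ with $b \in L$ implies $a \in L$, and if for all $x \in A$ one has $x^*x \in L_+$ if and only if $xx^* \in L_+$. For a Dixmier ideal $L$ and $s \in (0,\infty)$, let $L^s$ denote the complex linear span of $\{a^s : a \in L_+\}$. The Dixmier interior of an ideal $I$ is the sum of all Dixmier ideals contained in $I$, and its Dixmier closure is the intersection of all Dixmier ideals containing $I$. An ideal $P \neq A$ is prime if, for all ideals $L, M$ of $A$, $LM \subseteq P$ implies $L \subseteq P$ or $M \subseteq P$, where $LM$ is the additive subgroup generated by the products $xy$ with $x \in L$, $y \in M$. The semiprime closure $\sqrt{I}$ is the intersection of all prime ideals containing $I$, with $\sqrt{I} = A$ if there are none. Theorem. Let $I$ be an ideal of $A$, and let $J$ and $K$ be its Dixmier interior and Dixmier closure; these are Dixmier ideals.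 Then $$\sqrt{I} = \sqrt{J} = \sqrt{K} = \bigcup_{n=1}^\infty J^{1/n} = \bigcup_{n=1}^\infty K^{1/n}$$ $$= \{x \in A : (x^*x)^n \in I_+ \text{ for some } n \ge 1\} = \{x \in A : (xx^*)^n \in I_+ \text{ for some } n \ge 1\}.$$ In particular, $\sqrt{I}$ is the union of the increasing sequence $(J^{1/n})_{n \ge 1}$ of ideals, each of which is radical over $I$: for every $x \in J^{1/n}$ there is $m \ge 1$ with $x^m \in I$. -/

import Mathlib

open scoped NNReal

namespace CStarIdeal

section Ring

variable {R : Type*} [NonUnitalRing R]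

/-- The power `x ^ n` for `n ≥ 1` in a ring that need not have a unit
(the value at `n = 0` is a dummy value, never used below). -/
def nthPow (x : R) : ℕ → R
  | 0 => 0
  | 1 => x
  | n + 2 => nthPow x (n + 1) * x

/-- The product `J K` of two ideals: the additive subgroup generated by the products `x * y` with
`x ∈ J`, `y ∈ K`. -/
def idealMul (J K : TwoSidedIdeal R) : AddSubgroup R :=
  AddSubgroup.closure {z : R | ∃ x ∈ J, ∃ y ∈ K, z = x * y}

/-- Prime ideals of a (not necessarily unital or commutative) ring: `P ≠ R`, and `J K ⊆ P` implies
`J ⊆ P` or `K ⊆ P` for all two-sided ideals `J`, `K`. -/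
def IsPrimeIdeal (P : TwoSidedIdeal R) : Prop :=
  P ≠ ⊤ ∧ ∀ J K : TwoSidedIdeal R, (idealMul J K : Set R) ⊆ P → J ≤ P ∨ K ≤ P

/-- The semiprime closure `√I`: the intersection of all prime ideals containing `I`
(the whole ring, if there are none). -/
def semiprimeClosure (I : TwoSidedIdeal R) : TwoSidedIdeal R :=
  sInf {P : TwoSidedIdeal R | IsPrimeIdeal P ∧ I ≤ P}

/-- Every element of `S` has some power, with exponent at least `1`, in the ideal `I`. -/
def IsRadicalOver (S : Set R) (I : TwoSidedIdeal R) : Prop :=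
  ∀ x ∈ S, ∃ n : ℕ, 1 ≤ n ∧ nthPow x n ∈ I

end Ring

noncomputable section CStar

variable {A : Type*} [NonUnitalCStarAlgebra A] [PartialOrder A] [StarOrderedRing A]

/-- The positive part `I₊ = I ∩ A₊` of an ideal. -/
def positivePart (I : TwoSidedIdeal A) : Set A :=
  {a : A | a ∈ I ∧ 0 ≤ a}

/-- A Dixmier ideal: a (not necessarily norm-closed) two-sided ideal that is the complex linear
span of its positive part, is hereditary, and has a strongly invariant positive part. -/
structure IsDixmier (I : TwoSidedIdeal A) : Prop where
  positively_spanned : (I : Set A) = (Submodule.span ℂ (positivePart I) : Set A)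
  hereditary : ∀ a b : A, 0 ≤ a → a ≤ b → b ∈ positivePart I → a ∈ positivePart I
  strongly_invariant : ∀ x : A, star x * x ∈ positivePart I ↔ x * star x ∈ positivePart I

/-- The Dixmier interior: the join of all Dixmier ideals contained in `I`. -/
def dixmierInterior (I : TwoSidedIdeal A) : TwoSidedIdeal A :=
  sSup {J : TwoSidedIdeal A | IsDixmier J ∧ J ≤ I}

/-- The Dixmier closure: the intersection of all Dixmier ideals containing `I`. -/
def dixmierClosure (I : TwoSidedIdeal A) : TwoSidedIdeal A :=
  sInf {J : TwoSidedIdeal A | IsDixmier J ∧ I ≤ J}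

/-- The power `I ^ s` of a Dixmier ideal, for a real exponent `s > 0`: the complex linear span of
all `a ^ s` with `a ∈ I₊`, where `a ^ s` is given by continuous functional calculus. -/
def dixmierPow (I : TwoSidedIdeal A) (s : ℝ≥0) : Submodule ℂ A :=
  Submodule.span ℂ {b : A | ∃ a ∈ positivePart I, b = a ^ s}

end CStar

end CStarIdeal

set_option linter.unusedSectionVars false

namespace CStarIdeal

open Filter Topology

variable {A : Type*} [NonUnitalCStarAlgebra A] [PartialOrder A] [StarOrderedRing A]

/-! The proof works with positive cones. A Dixmier ideal is spanned by its positive part, a set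
closed under sums and under passing from `star x * x ≤ c` to `x * star x`. Conversely, such a cone
spans an ideal with no further positive elements (`positivePart_toIdeal`), and its `n`-th roots
again form such a cone (`isDixmierCone_rootCone`). So J^{1/n} is a Dixmier ideal.

J^{1/n} ⊆ √I: products of two elements of the span of the square-root cone fall into the span of the
original cone. A prime containing the latter thus contains the former, and iterating reaches the
roots of order 2^k ≥ n (`span_rootCone_two_pow_subset`).

Conversely, by Zorn's lemma every element of √I has a power in I, so (x⋆x)^n ∈ I whenever x ∈ √I.
Its fourth power lies in J (`fourth_power_mem_dixmierInterior`), and x is a left multiple of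
(x⋆x)^{1/4}; hence x ∈ J^{1/(16n)}. With n = 1 this puts I, and therefore K, inside J^{1/16} ⊆ √I.

The analytic tool is right division by d of those x with x⋆x ≤ d⁴ (`exists_right_quotient`). It
yields Riesz decomposition, subadditivity of the square root and the fourth-power lemma. -/

/-! ### Division by a positive element and decompositions. -/

/-- Approximate inverses of a positive element `d`, obtained by functional calculus. -/
theorem exists_approx_inverse {d : A} (hd : 0 ≤ d) :
    ∃ h : ℕ → A, (∀ n, star (h n) = h n) ∧ (∀ n, d * h n = h n * d) ∧
      (∀ n, ‖d * h n‖ ≤ 1) ∧ (∀ n, ‖d * d * h n - d‖ ≤ 1 / ((n : ℝ) + 1)) := by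
  have hsa : IsSelfAdjoint d := .of_nonneg hd
  -- A truncation of 1/s that vanishes at 0, as the non-unital calculus requires; s * g s stays in
  -- [0, 1] on the spectrum, and s² * g s - s is 0 above the cutoff.
  let g : ℕ → ℝ → ℝ := fun n s => s / (max s (1 / ((n : ℝ) + 1))) ^ 2
  have hpos : ∀ n : ℕ, 0 < 1 / ((n : ℝ) + 1) := fun n => by positivity
  have hm : ∀ (n : ℕ) (s : ℝ), 0 < max s (1 / ((n : ℝ) + 1)) := fun n s =>
    lt_max_of_lt_right (hpos n)
  have hgc : ∀ n, Continuous (g n) := fun n => by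
    refine continuous_id.div (by fun_prop) fun s => ?_
    exact (pow_pos (hm n s) 2).ne'
  have hg0 : ∀ n, g n 0 = 0 := fun n => by simp [g]
  have hid : cfcₙ (fun s : ℝ => s) d = d := cfcₙ_id' ℝ d
  have hnn : ∀ s ∈ quasispectrum ℝ d, 0 ≤ s := fun s hs => quasispectrum_nonneg_of_nonneg d hd s hs
  have hmul : ∀ n, d * cfcₙ (g n) d = cfcₙ (fun s => s * g n s) d := fun n => by
    rw [cfcₙ_mul (fun s : ℝ => s) (g n) d (by fun_prop) rfl (hgc n).continuousOn (hg0 n), hid]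
  have hmul' : ∀ n, cfcₙ (g n) d * d = cfcₙ (fun s => s * g n s) d := fun n => by
    simp_rw [mul_comm _ (g n _)]
    rw [cfcₙ_mul (g n) (fun s : ℝ => s) d (hgc n).continuousOn (hg0 n) (by fun_prop) rfl, hid]
  refine ⟨fun n => cfcₙ (g n) d, fun n => (cfcₙ_predicate (R := ℝ) (g n) d).star_eq,
    fun n => by rw [hmul, hmul'], fun n => ?_, fun n => ?_⟩
  · rw [hmul]
    refine norm_cfcₙ_le fun s hs => ?_
    have h0 := hnn s hs
    have h1 : s * g n s = (s / max s (1 / ((n : ℝ) + 1))) ^ 2 := by simp only [g]; ring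
    rw [h1, Real.norm_of_nonneg (by positivity)]
    exact pow_le_one₀ (by have := hm n s; positivity) ((div_le_one (hm n s)).2 (le_max_left _ _))
  · have h2 : d * d * cfcₙ (g n) d - d = cfcₙ (fun s => s * (s * g n s) - s) d := by
      have hc := hgc n
      rw [cfcₙ_sub (fun s => s * (s * g n s)) (fun s : ℝ => s) d (by fun_prop) (by simp)
        (by fun_prop) rfl, hid, cfcₙ_mul (fun s : ℝ => s) (fun s => s * g n s) d (by fun_prop) rfl
        (by fun_prop) (by simp), hid, ← hmul, mul_assoc]
    rw [h2]
    refine norm_cfcₙ_le fun s hs => ?_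
    have h0 := hnn s hs
    rcases le_total (1 / ((n : ℝ) + 1)) s with h | h
    · have hs0 : s ≠ 0 := ((hpos n).trans_le h).ne'
      have : s * (s * g n s) - s = 0 := by
        simp only [g, max_eq_left h]; field_simp; ring
      rw [this]; simpa using (hpos n).le
    · have h1 : s * g n s = (s / max s (1 / ((n : ℝ) + 1))) ^ 2 := by simp only [g]; ring
      have h3 : (s / max s (1 / ((n : ℝ) + 1))) ^ 2 ≤ 1 :=
        pow_le_one₀ (by have := hm n s; positivity) ((div_le_one (hm n s)).2 (le_max_left _ _))
      have h4 : 0 ≤ (s / max s (1 / ((n : ℝ) + 1))) ^ 2 := by positivity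
      rw [h1, Real.norm_eq_abs, abs_le]
      constructor <;> nlinarith

theorem norm_le_of_star_mul_self_le {x y : A} (h : star x * x ≤ star y * y) :
    ‖x‖ ≤ ‖y‖ := by
  have := CStarAlgebra.norm_le_norm_of_nonneg_of_le (star_mul_self_nonneg x) h
  rw [CStarRing.norm_star_mul_self, CStarRing.norm_star_mul_self] at this
  exact (mul_self_le_mul_self_iff (norm_nonneg x) (norm_nonneg y)).2 this

/-- The operator of division on the right by a positive element `d`, defined on those `x` with
`x⋆ x ≤ d ^ 4`. -/
theorem exists_right_quotient {d : A} (hd : 0 ≤ d) :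
    ∃ F : A → A, (∀ x, star x * x ≤ d * d * (d * d) →
        F x * d = x ∧ star (F x) * F x ≤ d * d) ∧
      (∀ x y, star x * x + star y * y = d * d * (d * d) →
        star (F x) * F x + star (F y) * F y = d * d) ∧
      (∀ a, 0 ≤ a → a ≤ d * d → a * a ≤ d * d * (d * d) → F a * star (F a) ≤ a) := by
  have hds : star d = d := (IsSelfAdjoint.of_nonneg hd).star_eq
  obtain ⟨h, hs, hc, h1, h2⟩ := exists_approx_inverse hd
  have htend : Tendsto (fun n => d * d * h n) atTop (𝓝 d) := by
    rw [tendsto_iff_norm_sub_tendsto_zero]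
    exact squeeze_zero (fun _ => norm_nonneg _) h2 tendsto_one_div_add_atTop_nhds_zero_nat
  have htend' : Tendsto (fun n => h n * (d * d)) atTop (𝓝 d) := by
    have := htend.star
    simpa [hs, hds] using this
  have hcauchy : ∀ x, star x * x ≤ d * d * (d * d) → CauchySeq fun n => x * h n := by
    intro x hx
    -- Conjugating x⋆x ≤ d⁴ by `h n - h m` compares with the convergent sequence d² h n.
    have key : ∀ n m, ‖x * h n - x * h m‖ ≤ ‖d * d * h n - d * d * h m‖ := by
      intro n m
      apply norm_le_of_star_mul_self_le
      have := star_left_conjugate_le_conjugate hx (h n - h m)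
      rw [← mul_sub, ← mul_sub]
      simpa only [star_mul, star_sub, hs, hds, mul_assoc] using this
    refine Metric.cauchySeq_iff.2 fun ε hε => ?_
    obtain ⟨N, hN⟩ := Metric.cauchySeq_iff.1 htend.cauchySeq ε hε
    refine ⟨N, fun m hm n hn => ?_⟩
    rw [dist_eq_norm]
    exact (key m n).trans_lt (by simpa [dist_eq_norm] using hN m hm n hn)
  let F : A → A := fun x => limUnder atTop fun n => x * h n
  have hF : ∀ x, star x * x ≤ d * d * (d * d) → Tendsto (fun n => x * h n) atTop (𝓝 (F x)) :=
    fun x hx => (hcauchy x hx).tendsto_limUnder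
  have hdd : Tendsto (fun n => h n * (d * d * (d * d)) * h n) atTop (𝓝 (d * d)) := by
    have := htend'.mul htend
    refine this.congr fun n => ?_
    simp only [mul_assoc]
  have hFF : ∀ x, star x * x ≤ d * d * (d * d) →
      Tendsto (fun n => h n * (star x * x) * h n) atTop (𝓝 (star (F x) * F x)) := by
    intro x hx
    refine ((hF x hx).star.mul (hF x hx)).congr fun n => ?_
    simp only [star_mul, hs, mul_assoc]
  refine ⟨F, fun x hx => ⟨?_, ?_⟩, fun x y hxy => ?_, fun a ha had _ => ?_⟩
  · have hlim : Tendsto (fun n => x * h n * d) atTop (𝓝 (F x * d)) := (hF x hx).mul_const d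
    refine tendsto_nhds_unique hlim ?_
    rw [tendsto_iff_norm_sub_tendsto_zero]
    -- Write d⁴ = x⋆x + w⋆w. The square of z h d - z depends additively on z⋆z, so the error for d²
    -- dominates that for x.
    have hbound : ∀ n, ‖x * h n * d - x‖ ≤ ‖d * d * h n * d - d * d‖ := by
      intro n
      obtain ⟨w, hw⟩ := CStarAlgebra.nonneg_iff_eq_star_mul_self.1 (sub_nonneg.2 hx)
      apply norm_le_of_star_mul_self_le
      have e : star (d * d * h n * d - d * d) * (d * d * h n * d - d * d)
          = star (x * h n * d - x) * (x * h n * d - x)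
            + star (w * h n * d - w) * (w * h n * d - w) := by
        have hw' : d * d * (d * d) = star x * x + star w * w := by rw [← hw]; abel
        have exp : ∀ z : A, star (z * h n * d - z) * (z * h n * d - z)
            = d * h n * (star z * z) * h n * d - d * h n * (star z * z)
              - (star z * z) * h n * d + star z * z := by
          intro z
          simp only [star_sub, star_mul, hs, hds]
          noncomm_ring
        have e0 : star (d * d) * (d * d) = star x * x + star w * w := by
          rw [← hw']; simp [hds]
        rw [exp x, exp w, exp (d * d), e0]
        noncomm_ring
      rw [e]
      exact le_add_of_nonneg_right (star_mul_self_nonneg _)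
    refine squeeze_zero (fun _ => norm_nonneg _) hbound ?_
    have := (htend.mul_const d).sub_const (d * d)
    simpa using this.norm
  · refine le_of_tendsto_of_tendsto' (hFF x hx) hdd fun n => ?_
    simpa only [hs] using star_left_conjugate_le_conjugate hx (h n)
  · have hx : star x * x ≤ d * d * (d * d) := hxy ▸ le_add_of_nonneg_right (star_mul_self_nonneg _)
    have hy : star y * y ≤ d * d * (d * d) := hxy ▸ le_add_of_nonneg_left (star_mul_self_nonneg _)
    refine tendsto_nhds_unique ((hFF x hx).add (hFF y hy)) (hdd.congr fun n => ?_)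
    rw [← hxy]; noncomm_ring
  · have has : star a = a := (IsSelfAdjoint.of_nonneg ha).star_eq
    have hT := hF a (by rwa [has])
    refine le_of_tendsto' (hT.mul hT.star) fun n => ?_
    set r := CFC.sqrt a with hr
    have hr0 : 0 ≤ r := CFC.sqrt_nonneg a
    have hrs : star r = r := (IsSelfAdjoint.of_nonneg hr0).star_eq
    have hrr : r * r = a := CFC.sqrt_mul_sqrt_self a ha
    -- Here a ≤ d² enters: a h h a = r (r h)(r h)⋆ r, and the middle factor has norm at most 1.
    have hn : ‖r * h n‖ ≤ ‖d * h n‖ := by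
      apply norm_le_of_star_mul_self_le
      have := star_left_conjugate_le_conjugate had (h n)
      rw [← hrr] at this
      simpa only [star_mul, hs, hrs, hds, mul_assoc] using this
    have hn1 : ‖(r * h n) * star (r * h n)‖ ≤ 1 := by
      rw [CStarRing.norm_self_mul_star]
      nlinarith [h1 n, norm_nonneg (r * h n)]
    have hle := CStarAlgebra.star_left_conjugate_le_norm_smul (a := r)
      (b := (r * h n) * star (r * h n)) (.mul_star_self _)
    calc a * h n * star (a * h n) = star r * ((r * h n) * star (r * h n)) * r := by
          rw [← hrr]; simp only [star_mul, hs, hrs, mul_assoc]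
      _ ≤ ‖(r * h n) * star (r * h n)‖ • (star r * r) := hle
      _ ≤ (1 : ℝ) • (star r * r) := smul_le_smul_of_nonneg_right hn1 (star_mul_self_nonneg r)
      _ = a := by rw [one_smul, hrs, hrr]

theorem exists_fourth_root {c : A} (hc : 0 ≤ c) :
    ∃ d : A, 0 ≤ d ∧ d * d * (d * d) = c ∧ d * d = CFC.sqrt c := by
  refine ⟨CFC.sqrt (CFC.sqrt c), CFC.sqrt_nonneg _, ?_, ?_⟩ <;>
  simp only [CFC.sqrt_mul_sqrt_self _ (CFC.sqrt_nonneg _), CFC.sqrt_mul_sqrt_self _ hc]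

/-- Riesz decomposition, up to equivalence. -/
theorem riesz_decomposition {x v w : A} (h : star x * x ≤ star v * v + star w * w) :
    ∃ y z : A, x * star x = y * star y + z * star z ∧
      star y * y ≤ v * star v ∧ star z * z ≤ w * star w := by
  obtain ⟨d, hd, hd4, -⟩ := exists_fourth_root
    (add_nonneg (star_mul_self_nonneg v) (star_mul_self_nonneg w))
  have hds : star d = d := (IsSelfAdjoint.of_nonneg hd).star_eq
  obtain ⟨F, hF1, hF2, -⟩ := exists_right_quotient hd
  obtain ⟨hx1, hx2⟩ := hF1 x (by rwa [hd4])
  obtain ⟨hv1, -⟩ := hF1 v (by rw [hd4]; exact le_add_of_nonneg_right (star_mul_self_nonneg _))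
  obtain ⟨hw1, -⟩ := hF1 w (by rw [hd4]; exact le_add_of_nonneg_left (star_mul_self_nonneg _))
  have hvw := hF2 v w hd4.symm
  have aux : ∀ z, F z * d = z → star (F x * star (F z)) * (F x * star (F z)) ≤ z * star z := by
    intro z hz
    have := star_left_conjugate_le_conjugate hx2 (star (F z))
    conv_rhs => rw [← hz]
    simpa only [star_mul, star_star, hds, mul_assoc] using this
  -- Since xx⋆ = F(x) d² F(x)⋆, splitting d² by `hvw` splits xx⋆.
  refine ⟨F x * star (F v), F x * star (F w), ?_, aux v hv1, aux w hw1⟩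
  calc x * star x = F x * (d * d) * star (F x) := by
        conv_lhs => rw [← hx1]
        simp only [star_mul, hds, mul_assoc]
    _ = _ := by
        rw [← hvw]; simp only [star_mul, star_star]; noncomm_ring

theorem riesz_decomposition_single {x w : A} (h : star x * x ≤ star w * w) :
    ∃ z : A, x * star x = z * star z ∧ star z * z ≤ w * star w := by
  obtain ⟨y, z, h1, h2, h3⟩ := riesz_decomposition (v := 0) (w := w) (x := x) (by simpa using h)
  have hy : y = 0 := by
    have := le_antisymm (by simpa using h2) (star_mul_self_nonneg y)
    exact CStarRing.star_mul_self_eq_zero_iff y |>.1 this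
  exact ⟨z, by simpa [hy] using h1, h3⟩

/-- Rotfel'd's subadditivity of the square root, up to equivalence. -/
theorem sqrt_add_decomposition {a b : A} (ha : 0 ≤ a) (hb : 0 ≤ b) :
    ∃ u v : A, CFC.sqrt (a * a + b * b) = star u * u + star v * v ∧
      u * star u ≤ a ∧ v * star v ≤ b := by
  have has : star a = a := (IsSelfAdjoint.of_nonneg ha).star_eq
  have hbs : star b = b := (IsSelfAdjoint.of_nonneg hb).star_eq
  have ha2 : 0 ≤ a * a := by simpa [has] using star_mul_self_nonneg a
  have hb2 : 0 ≤ b * b := by simpa [hbs] using star_mul_self_nonneg b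
  obtain ⟨d, hd, hd4, hd2⟩ := exists_fourth_root (add_nonneg ha2 hb2)
  obtain ⟨F, -, hF2, hF3⟩ := exists_right_quotient hd
  have h1 : a * a ≤ d * d * (d * d) := hd4 ▸ le_add_of_nonneg_right hb2
  have h2 : b * b ≤ d * d * (d * d) := hd4 ▸ le_add_of_nonneg_left ha2
  refine ⟨F a, F b, ?_, hF3 a ha ?_ h1, hF3 b hb ?_ h2⟩
  · rw [hF2 a b (by rw [has, hbs, hd4]), hd2]
  · have := CFC.sqrt_le_sqrt _ _ (hd4 ▸ h1)
    rwa [CFC.sqrt_mul_self a ha, ← hd2] at this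
  · have := CFC.sqrt_le_sqrt _ _ (hd4 ▸ h2)
    rwa [CFC.sqrt_mul_self b hb, ← hd2] at this

/-- If `x⋆ x ≤ d ^ 4` with `d ≥ 0`, then `x` is a left multiple of `d`. -/
theorem exists_eq_mul_of_le {x d : A} (hd : 0 ≤ d) (h : star x * x ≤ d * d * (d * d)) :
    ∃ u : A, x = u * d := by
  obtain ⟨F, hF1, -, -⟩ := exists_right_quotient hd
  exact ⟨F x, (hF1 x h).1.symm⟩

/-! ### Dixmier cones and the ideals they span. -/

/-- The cones of positive elements that are hereditary and strongly invariant; these are the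
positive parts of Dixmier ideals. -/
structure IsDixmierCone (C : Set A) : Prop where
  zero_mem : 0 ∈ C
  add_mem : ∀ {a b : A}, a ∈ C → b ∈ C → a + b ∈ C
  nonneg : ∀ {a : A}, a ∈ C → 0 ≤ a
  transfer : ∀ {x c : A}, c ∈ C → star x * x ≤ c → x * star x ∈ C

theorem star_add_mul_add_le (x y : A) :
    star (x + y) * (x + y) ≤ (2 : ℝ) • (star x * x) + (2 : ℝ) • (star y * y) := by
  have h := star_mul_self_nonneg (x - y)
  have e : (2 : ℝ) • (star x * x) + (2 : ℝ) • (star y * y)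
      = star (x + y) * (x + y) + star (x - y) * (x - y) := by
    simp only [star_add, star_sub, two_smul]; noncomm_ring
  rw [e]
  exact le_add_of_nonneg_right h

theorem star_smul_mul_smul (t : ℂ) (x : A) :
    star (t • x) * (t • x) = (‖t‖ ^ 2 : ℝ) • (star x * x) := by
  rw [star_smul, smul_mul_assoc, mul_smul_comm, smul_smul, ← Complex.coe_smul]
  congr 1
  simpa using Complex.conj_mul' t

theorem star_sqrt (a : A) : star (CFC.sqrt a) = CFC.sqrt a :=
  (IsSelfAdjoint.of_nonneg (CFC.sqrt_nonneg a)).star_eq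

theorem mul_self_nonneg_of_nonneg {a : A} (ha : 0 ≤ a) : 0 ≤ a * a := by
  simpa [(IsSelfAdjoint.of_nonneg ha).star_eq] using star_mul_self_nonneg a

namespace IsDixmierCone

variable {C : Set A} (hC : IsDixmierCone C)
include hC

/-- Heredity is the transfer axiom for the self-adjoint element √a. -/
theorem mem_of_le {a c : A} (ha : 0 ≤ a) (hc : c ∈ C) (hac : a ≤ c) : a ∈ C := by
  have h : star (CFC.sqrt a) * CFC.sqrt a = a := by
    rw [star_sqrt, CFC.sqrt_mul_sqrt_self a ha]
  have := hC.transfer (x := CFC.sqrt a) hc (h.trans_le hac)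
  rwa [star_sqrt, CFC.sqrt_mul_sqrt_self a ha] at this

theorem smul_mem {a : A} (ha : a ∈ C) {t : ℝ} (ht : 0 ≤ t) : t • a ∈ C := by
  obtain ⟨n, hn⟩ := exists_nat_ge t
  have h0 := hC.nonneg ha
  have hna : ∀ n : ℕ, n • a ∈ C := fun n => by
    induction n with
    | zero => simpa using hC.zero_mem
    | succ n ih => rw [succ_nsmul]; exact hC.add_mem ih ha
  refine hC.mem_of_le (smul_nonneg ht h0) (hna n) ?_
  rw [← Nat.cast_smul_eq_nsmul ℝ]
  exact smul_le_smul_of_nonneg_right hn h0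

theorem swap {x : A} (hx : star x * x ∈ C) : x * star x ∈ C := hC.transfer hx le_rfl

/-- The square root of a Dixmier cone: the elements `x` with `x⋆ x` in the cone. -/
def half : Submodule ℂ A where
  carrier := {x | star x * x ∈ C}
  zero_mem' := by simpa using hC.zero_mem
  add_mem' := fun {x y} hx hy => hC.mem_of_le (star_mul_self_nonneg _)
    (hC.add_mem (hC.smul_mem hx zero_le_two) (hC.smul_mem hy zero_le_two))
    (star_add_mul_add_le x y)
  smul_mem' := fun t x hx => by
    simp only [Set.mem_ofPred_eq, star_smul_mul_smul]
    exact hC.smul_mem hx (by positivity)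

theorem mem_half {x : A} : x ∈ hC.half ↔ star x * x ∈ C := Iff.rfl

theorem star_mem_half {x : A} (hx : x ∈ hC.half) : star x ∈ hC.half := by
  rw [mem_half, star_star]; exact hC.swap hx

theorem mul_mem_half_left (z : A) {x : A} (hx : x ∈ hC.half) : z * x ∈ hC.half := by
  rw [mem_half] at hx ⊢
  refine hC.mem_of_le (star_mul_self_nonneg _) (hC.smul_mem hx (norm_nonneg (star z * z))) ?_
  have := CStarAlgebra.star_left_conjugate_le_norm_smul (a := x) (b := star z * z) (.star_mul_self z)
  simpa only [star_mul, mul_assoc] using this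

theorem mul_mem_half_right {x : A} (hx : x ∈ hC.half) (z : A) : x * z ∈ hC.half := by
  simpa using hC.star_mem_half (hC.mul_mem_half_left (star z) (hC.star_mem_half hx))

theorem sqrt_mem_half {a : A} (ha : a ∈ C) : CFC.sqrt a ∈ hC.half := by
  rwa [mem_half, star_sqrt, CFC.sqrt_mul_sqrt_self a (hC.nonneg ha)]

/-- Polarization of (x⋆)⋆ y. -/
theorem mul_mem_span {x y : A} (hx : x ∈ hC.half) (hy : y ∈ hC.half) :
    x * y ∈ Submodule.span ℂ C := by
  have hsq : ∀ z ∈ hC.half, star z * z ∈ Submodule.span ℂ C := fun z hz =>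
    Submodule.subset_span hz
  have hx' := hC.star_mem_half hx
  have hiy := hC.half.smul_mem Complex.I hy
  have e : x * y = (1 / 4 : ℂ) • (star (star x + y) * (star x + y)
      - star (star x - y) * (star x - y)
      - Complex.I • (star (star x + Complex.I • y) * (star x + Complex.I • y))
      + Complex.I • (star (star x - Complex.I • y) * (star x - Complex.I • y))) := by
    have h4 : star (star x + y) * (star x + y)
      - star (star x - y) * (star x - y)
      - Complex.I • (star (star x + Complex.I • y) * (star x + Complex.I • y))
      + Complex.I • (star (star x - Complex.I • y) * (star x - Complex.I • y))
      = (4 : ℂ) • (x * y) := by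
      simp only [star_add, star_sub, star_star, star_smul, add_mul, mul_add, sub_mul, mul_sub,
        smul_mul_assoc, mul_smul_comm, smul_add, smul_sub, smul_smul]
      have hI : star Complex.I = -Complex.I := Complex.conj_I
      simp only [hI, mul_neg, Complex.I_mul_I, neg_neg, one_smul, neg_smul]
      module
    rw [h4, smul_smul]; norm_num
  rw [e]
  refine Submodule.smul_mem _ _ (AddMemClass.add_mem (sub_mem (sub_mem (hsq _ (AddMemClass.add_mem hx' hy))
    (hsq _ (sub_mem hx' hy))) (Submodule.smul_mem _ _ (hsq _ (AddMemClass.add_mem hx' hiy))))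
    (Submodule.smul_mem _ _ (hsq _ (sub_mem hx' hiy))))

theorem mul_span_mem (z : A) {x : A} (hx : x ∈ Submodule.span ℂ C) :
    z * x ∈ Submodule.span ℂ C := by
  induction hx using Submodule.span_induction with
  | mem a ha =>
    have h := hC.sqrt_mem_half ha
    rw [← CFC.sqrt_mul_sqrt_self a (hC.nonneg ha), ← mul_assoc]
    exact hC.mul_mem_span (hC.mul_mem_half_left z h) h
  | zero => simp
  | add x y _ _ hx hy => rw [mul_add]; exact AddMemClass.add_mem hx hy
  | smul t x _ hx => rw [mul_smul_comm]; exact Submodule.smul_mem _ _ hx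

theorem span_mul_mem {x : A} (hx : x ∈ Submodule.span ℂ C) (z : A) :
    x * z ∈ Submodule.span ℂ C := by
  induction hx using Submodule.span_induction with
  | mem a ha =>
    have h := hC.sqrt_mem_half ha
    rw [← CFC.sqrt_mul_sqrt_self a (hC.nonneg ha), mul_assoc]
    exact hC.mul_mem_span h (hC.mul_mem_half_right h z)
  | zero => simp
  | add x y _ _ hx hy => rw [add_mul]; exact AddMemClass.add_mem hx hy
  | smul t x _ hx => rw [smul_mul_assoc]; exact Submodule.smul_mem _ _ hx

/-- The two-sided ideal spanned by a Dixmier cone. -/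
def toIdeal : TwoSidedIdeal A :=
  .mk' (Submodule.span ℂ C : Set A) (ZeroMemClass.zero_mem _) AddMemClass.add_mem neg_mem
    (fun {z _} hx => hC.mul_span_mem z hx) (fun {_ z} hx => hC.span_mul_mem hx z)

theorem coe_toIdeal : (hC.toIdeal : Set A) = Submodule.span ℂ C := TwoSidedIdeal.coe_mk' ..

theorem mem_toIdeal {x : A} : x ∈ hC.toIdeal ↔ x ∈ Submodule.span ℂ C := by
  rw [← SetLike.mem_coe, coe_toIdeal, SetLike.mem_coe]

theorem subset_toIdeal {a : A} (ha : a ∈ C) : a ∈ hC.toIdeal :=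
  hC.mem_toIdeal.2 (Submodule.subset_span ha)

theorem sqrt_add_mul_self_mem {a b : A} (ha : a ∈ C) (hb : b ∈ C) :
    CFC.sqrt (a * a + b * b) ∈ C := by
  obtain ⟨u, v, h, hu, hv⟩ := sqrt_add_decomposition (hC.nonneg ha) (hC.nonneg hb)
  rw [h]
  refine hC.add_mem ?_ ?_
  · simpa using hC.transfer (x := star u) ha (by simpa using hu)
  · simpa using hC.transfer (x := star v) hb (by simpa using hv)

/-- The elements with absolute value in a Dixmier cone form a subspace. -/
def absSubmodule : Submodule ℂ A where
  carrier := {x | CFC.abs x ∈ C}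
  zero_mem' := by simpa using hC.zero_mem
  add_mem' := fun {x y} hx hy => by
    -- |x + y|² ≤ 2|x|² + 2|y|², so each summand is the square of √2 times an absolute value.
    have h2 : (0 : ℝ) ≤ √2 := Real.sqrt_nonneg 2
    refine hC.mem_of_le (CFC.abs_nonneg _)
      (hC.sqrt_add_mul_self_mem (hC.smul_mem hx h2) (hC.smul_mem hy h2)) ?_
    refine CFC.sqrt_le_sqrt _ _ ((star_add_mul_add_le x y).trans_eq ?_)
    simp only [smul_mul_assoc, mul_smul_comm, smul_smul, CFC.abs_mul_abs,
      Real.mul_self_sqrt zero_le_two]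
  smul_mem' := fun t x hx => by
    simp only [Set.mem_ofPred_eq, CFC.abs_smul]
    exact hC.smul_mem hx (norm_nonneg t)

theorem abs_mem {x : A} (hx : x ∈ Submodule.span ℂ C) : CFC.abs x ∈ C := by
  have : Submodule.span ℂ C ≤ hC.absSubmodule := Submodule.span_le.2 fun a ha => by
    change CFC.abs a ∈ C
    rwa [CFC.abs_of_nonneg a (hC.nonneg ha)]
  exact this hx

/-- Absolute values of elements of the span stay in the cone, and a positive element is its own
absolute value. -/
theorem positivePart_toIdeal : positivePart hC.toIdeal = C := by
  ext a
  refine ⟨fun ⟨h, h0⟩ => ?_, fun h => ⟨hC.subset_toIdeal h, hC.nonneg h⟩⟩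
  have := hC.abs_mem (hC.mem_toIdeal.1 h)
  rwa [CFC.abs_of_nonneg a h0] at this

theorem isDixmier_toIdeal : IsDixmier hC.toIdeal where
  positively_spanned := by rw [positivePart_toIdeal, coe_toIdeal]
  hereditary a b ha hab hb := by
    rw [positivePart_toIdeal] at hb ⊢
    exact hC.mem_of_le ha hb hab
  strongly_invariant x := by
    rw [positivePart_toIdeal]
    refine ⟨hC.swap, fun h => ?_⟩
    simpa using hC.swap (x := star x) (by simpa using h)

end IsDixmierCone

/-! ### Dixmier ideals, closure and interior. -/

namespace IsDixmier

variable {I : TwoSidedIdeal A} (hI : IsDixmier I)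
include hI

theorem isDixmierCone : IsDixmierCone (positivePart I) where
  zero_mem := ⟨I.zero_mem, le_rfl⟩
  add_mem ha hb := ⟨I.add_mem ha.1 hb.1, add_nonneg ha.2 hb.2⟩
  nonneg ha := ha.2
  transfer {x c} hc h :=
    (hI.strongly_invariant x).1 (hI.hereditary _ c (star_mul_self_nonneg x) h hc)

theorem mem_iff {x : A} : x ∈ I ↔ x ∈ Submodule.span ℂ (positivePart I) := by
  rw [← SetLike.mem_coe, hI.positively_spanned, SetLike.mem_coe]

theorem smul_mem (t : ℂ) {x : A} (hx : x ∈ I) : t • x ∈ I := by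
  rw [hI.mem_iff] at hx ⊢
  exact Submodule.smul_mem _ _ hx

theorem star_mem {x : A} (hx : x ∈ I) : star x ∈ I := by
  rw [hI.mem_iff] at hx
  induction hx using Submodule.span_induction with
  | mem a ha => rw [(IsSelfAdjoint.of_nonneg ha.2).star_eq]; exact ha.1
  | zero => simp
  | add x y _ _ hx hy => rw [star_add]; exact I.add_mem hx hy
  | smul t x _ hx => rw [star_smul]; exact hI.smul_mem _ hx

theorem posPart_mem {x : A} (hx : x ∈ I) (hsa : IsSelfAdjoint x) : x⁺ ∈ I := by
  have h : (CFC.abs x) ∈ I := (hI.isDixmierCone.abs_mem (hI.mem_iff.1 hx)).1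
  have e : x⁺ = (1 / 2 : ℂ) • (CFC.abs x + x) := by
    rw [CFC.abs_add_self x hsa, ← Nat.cast_smul_eq_nsmul ℂ, smul_smul]; norm_num
  rw [e]
  exact hI.smul_mem _ (I.add_mem h hx)

theorem negPart_mem {x : A} (hx : x ∈ I) (hsa : IsSelfAdjoint x) : x⁻ ∈ I := by
  have := hI.posPart_mem (I.neg_mem hx) hsa.neg
  rwa [CFC.posPart_neg] at this

end IsDixmier

/-- Positive spanning survives intersection because each Dixmier ideal contains the positive and
negative parts of its self-adjoint elements. -/
theorem isDixmier_sInf {S : Set (TwoSidedIdeal A)} (hS : ∀ L ∈ S, IsDixmier L) :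
    IsDixmier (sInf S) where
  positively_spanned := by
    have hpos : ∀ y ∈ sInf S, IsSelfAdjoint y → y ∈ Submodule.span ℂ (positivePart (sInf S)) := by
      intro y hy hsa
      rw [TwoSidedIdeal.mem_sInf] at hy
      rw [← CFC.posPart_sub_negPart y hsa]
      refine sub_mem (Submodule.subset_span ⟨?_, CFC.posPart_nonneg y⟩)
        (Submodule.subset_span ⟨?_, CFC.negPart_nonneg y⟩) <;> rw [TwoSidedIdeal.mem_sInf]
      · exact fun L hL => (hS L hL).posPart_mem (hy L hL) hsa
      · exact fun L hL => (hS L hL).negPart_mem (hy L hL) hsa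
    have hsmul : ∀ (t : ℂ) (y : A), y ∈ sInf S → t • y ∈ sInf S := by
      intro t y hy
      rw [TwoSidedIdeal.mem_sInf] at hy ⊢
      exact fun L hL => (hS L hL).smul_mem t (hy L hL)
    ext x
    refine ⟨fun hx => ?_, fun hx => ?_⟩
    · have hx' : star x ∈ sInf S := by
        rw [SetLike.mem_coe, TwoSidedIdeal.mem_sInf] at hx
        rw [TwoSidedIdeal.mem_sInf]
        exact fun L hL => (hS L hL).star_mem (hx L hL)
      have h1 := hpos (x + star x) ((sInf S).add_mem hx hx') (.add_star_self x)
      have h2 := hpos (Complex.I • (x - star x)) (hsmul _ _ ((sInf S).sub_mem hx hx')) (by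
        have hI : star Complex.I = -Complex.I := Complex.conj_I
        rw [isSelfAdjoint_iff, star_smul, star_sub, star_star, hI]; module)
      have e : x = (1 / 2 : ℂ) • (x + star x)
          + (-Complex.I / 2) • (Complex.I • (x - star x)) := by
        rw [smul_smul, show -Complex.I / 2 * Complex.I = (1 / 2 : ℂ) by
          linear_combination (-1 / 2 : ℂ) * Complex.I_mul_I]
        module
      rw [e]
      exact add_mem (Submodule.smul_mem _ _ h1) (Submodule.smul_mem _ _ h2)
    · rw [SetLike.mem_coe] at hx ⊢
      induction hx using Submodule.span_induction with
      | mem a ha => exact ha.1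
      | zero => exact TwoSidedIdeal.zero_mem _
      | add x y _ _ hx hy => exact TwoSidedIdeal.add_mem _ hx hy
      | smul t x _ hx => exact hsmul t x hx
  hereditary a b ha hab hb := by
    refine ⟨?_, ha⟩
    have hb1 := hb.1
    rw [TwoSidedIdeal.mem_sInf] at hb1 ⊢
    exact fun L hL => ((hS L hL).hereditary a b ha hab ⟨hb1 L hL, hb.2⟩).1
  strongly_invariant x := by
    simp only [positivePart, Set.mem_ofPred_eq, TwoSidedIdeal.mem_sInf, star_mul_self_nonneg,
      mul_star_self_nonneg, and_true]
    have h : ∀ L ∈ S, (star x * x ∈ L ↔ x * star x ∈ L) := fun L hL => by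
      simpa [positivePart] using (hS L hL).strongly_invariant x
    exact ⟨fun H L hL => (h L hL).1 (H L hL), fun H L hL => (h L hL).2 (H L hL)⟩

theorem isDixmier_dixmierClosure (I : TwoSidedIdeal A) : IsDixmier (dixmierClosure I) :=
  isDixmier_sInf fun _ hL => hL.1

theorem le_dixmierClosure (I : TwoSidedIdeal A) : I ≤ dixmierClosure I :=
  le_sInf fun _ hL => hL.2

theorem dixmierClosure_le {I L : TwoSidedIdeal A} (hL : IsDixmier L) (h : I ≤ L) :
    dixmierClosure I ≤ L :=
  sInf_le ⟨hL, h⟩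

/-- Riesz decomposition extends the transfer property from generators to their sums. -/
theorem isDixmierCone_closure {Z : Set A} (hZ0 : ∀ z ∈ Z, 0 ≤ z)
    (hZ : ∀ x z : A, z ∈ Z → star x * x ≤ z → x * star x ∈ Z) :
    IsDixmierCone (AddSubmonoid.closure Z : Set A) := by
  have hnn : ∀ s ∈ AddSubmonoid.closure Z, 0 ≤ s := fun s hs => by
    induction hs using AddSubmonoid.closure_induction with
    | mem z hz => exact hZ0 z hz
    | zero => exact le_rfl
    | add a b _ _ ha hb => exact add_nonneg ha hb
  refine ⟨zero_mem _, add_mem, fun {a} ha => hnn a ha, fun {x c} hc h => ?_⟩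
  rw [SetLike.mem_coe] at hc ⊢
  induction hc using AddSubmonoid.closure_induction generalizing x with
  | mem z hz => exact AddSubmonoid.subset_closure (hZ x z hz h)
  | zero =>
    have hx : x = 0 :=
      CStarRing.star_mul_self_eq_zero_iff x |>.1 (le_antisymm h (star_mul_self_nonneg x))
    simp [hx]
  | add a b ha hb iha ihb =>
    have ha' := CFC.sqrt_mul_sqrt_self a (hnn a ha)
    have hb' := CFC.sqrt_mul_sqrt_self b (hnn b hb)
    obtain ⟨y, z, e, hy, hz⟩ := riesz_decomposition (x := x) (v := CFC.sqrt a) (w := CFC.sqrt b)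
      (by rwa [star_sqrt, star_sqrt, ha', hb'])
    rw [star_sqrt, ha'] at hy
    rw [star_sqrt, hb'] at hz
    rw [e]
    exact add_mem (iha hy) (ihb hz)

/-- The hypothesis runs over all scalars because `I` need not be a complex subspace. -/
theorem span_closure_le {Z : Set A} {I : TwoSidedIdeal A} (h : ∀ (t : ℂ), ∀ z ∈ Z, t • z ∈ I)
    {x : A} (hx : x ∈ Submodule.span ℂ (AddSubmonoid.closure Z : Set A)) : x ∈ I := by
  have hall : ∀ t : ℂ, t • x ∈ I := by
    induction hx using Submodule.span_induction with
    | mem a ha =>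
      rw [SetLike.mem_coe] at ha
      induction ha using AddSubmonoid.closure_induction with
      | mem z hz => exact fun t => h t z hz
      | zero => exact fun t => by simp
      | add a b _ _ ha hb => exact fun t => by rw [smul_add]; exact I.add_mem (ha t) (hb t)
    | zero => exact fun t => by simp
    | add x y _ _ hx hy => exact fun t => by rw [smul_add]; exact I.add_mem (hx t) (hy t)
    | smul s x _ hx => exact fun t => by rw [smul_smul]; exact hx _
  simpa using hall 1

theorem le_dixmierInterior {I L : TwoSidedIdeal A} (hL : IsDixmier L) (h : L ≤ I) :
    L ≤ dixmierInterior I :=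
  le_sSup ⟨hL, h⟩

theorem dixmierInterior_le (I : TwoSidedIdeal A) : dixmierInterior I ≤ I :=
  sSup_le fun _ hL => hL.2

theorem isDixmier_dixmierInterior (I : TwoSidedIdeal A) : IsDixmier (dixmierInterior I) := by
  set Z : Set A := {a | ∃ L : TwoSidedIdeal A, (IsDixmier L ∧ L ≤ I) ∧ a ∈ positivePart L} with hZ
  have hC : IsDixmierCone (AddSubmonoid.closure Z : Set A) :=
    isDixmierCone_closure (fun z ⟨L, _, hz⟩ => hz.2) fun x z ⟨L, hL, hz⟩ h =>
      ⟨L, hL, hL.1.isDixmierCone.transfer hz h⟩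
  have hle : hC.toIdeal ≤ I := fun x hx =>
    span_closure_le (Z := Z) (fun t z ⟨L, hL, hz⟩ => hL.2 (hL.1.smul_mem t hz.1)) (hC.mem_toIdeal.1 hx)
  have heq : dixmierInterior I = hC.toIdeal := by
    refine le_antisymm (sSup_le fun L hL x hx => ?_) (le_dixmierInterior hC.isDixmier_toIdeal hle)
    rw [hC.mem_toIdeal]
    exact Submodule.span_mono (fun a ha => AddSubmonoid.subset_closure (s := Z) ⟨L, hL, ha⟩)
      (hL.1.mem_iff.1 hx)
  rw [heq]
  exact hC.isDixmier_toIdeal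

theorem dixmierInterior_eq_self {L : TwoSidedIdeal A} (hL : IsDixmier L) :
    dixmierInterior L = L :=
  le_antisymm (dixmierInterior_le L) (le_dixmierInterior hL le_rfl)

/-- Fourth powers of positive elements of an ideal lie in its Dixmier interior. -/
theorem fourth_power_mem_dixmierInterior {I : TwoSidedIdeal A} {d : A} (hd : d ∈ positivePart I) :
    d * d * (d * d) ∈ dixmierInterior I := by
  set Z : Set A := {a | ∃ z : A, star z * z ≤ d * d * (d * d) ∧ a = z * star z} with hZ
  have hds : star d = d := (IsSelfAdjoint.of_nonneg hd.2).star_eq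
  have hC : IsDixmierCone (AddSubmonoid.closure Z : Set A) := by
    refine isDixmierCone_closure ?_ ?_
    · rintro _ ⟨z, -, rfl⟩
      exact mul_star_self_nonneg z
    · rintro x _ ⟨z, hz, rfl⟩ h
      obtain ⟨y, hy, hyz⟩ := riesz_decomposition_single (x := x) (w := star z) (by simpa using h)
      exact ⟨y, (by simpa using hyz : star y * y ≤ star z * z).trans hz, hy⟩
  have hle : hC.toIdeal ≤ I := fun x hx => by
    refine span_closure_le ?_ (hC.mem_toIdeal.1 hx)
    rintro t _ ⟨z, hz, rfl⟩
    -- Division exposes a factor d ∈ I, and the scalar is absorbed into u.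
    obtain ⟨u, rfl⟩ := exists_eq_mul_of_le hd.2 hz
    have e : t • (u * d * star (u * d)) = (t • u) * d * (d * star u) := by
      rw [star_mul, hds]; simp only [smul_mul_assoc]
    rw [e]
    exact I.mul_mem_right _ _ (I.mul_mem_left _ _ hd.1)
  refine le_dixmierInterior hC.isDixmier_toIdeal hle (hC.subset_toIdeal
    (AddSubmonoid.subset_closure ⟨d * d, ?_, ?_⟩)) <;> rw [star_mul, hds]


/-! ### Powers and prime ideals in a ring. -/

section Ring

variable {R : Type*} [NonUnitalRing R]

theorem nthPow_succ (x : R) {n : ℕ} (hn : 1 ≤ n) : nthPow x (n + 1) = nthPow x n * x := by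
  obtain ⟨m, rfl⟩ := Nat.exists_eq_add_of_le' hn
  rfl

theorem nthPow_add (x : R) {m n : ℕ} (hm : 1 ≤ m) (hn : 1 ≤ n) :
    nthPow x (m + n) = nthPow x m * nthPow x n := by
  induction n, hn using Nat.le_induction with
  | base => exact nthPow_succ x hm
  | succ n hn ih =>
    rw [← add_assoc, nthPow_succ x (by omega), ih, nthPow_succ x hn, mul_assoc]

theorem nthPow_mul (x : R) {m n : ℕ} (hm : 1 ≤ m) (hn : 1 ≤ n) :
    nthPow x (m * n) = nthPow (nthPow x m) n := by
  induction n, hn using Nat.le_induction with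
  | base => rw [mul_one]; rfl
  | succ n hn ih =>
    rw [mul_add, mul_one, nthPow_add x (Nat.mul_pos hm hn) hm, ih, nthPow_succ _ hn]

/-- The union of a nonempty chain of two-sided ideals. -/
theorem exists_coe_eq_iUnion_of_isChain {c : Set (TwoSidedIdeal R)} (hc : IsChain (· ≤ ·) c)
    (hne : c.Nonempty) : ∃ U : TwoSidedIdeal R, ∀ x, x ∈ U ↔ ∃ L ∈ c, x ∈ L := by
  refine ⟨.mk' {x | ∃ L ∈ c, x ∈ L} ?_ ?_ ?_ ?_ ?_, fun x => ?_⟩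
  · obtain ⟨L, hL⟩ := hne
    exact ⟨L, hL, L.zero_mem⟩
  · rintro x y ⟨L, hL, hx⟩ ⟨M, hM, hy⟩
    rcases hc.total hL hM with h | h
    · exact ⟨M, hM, M.add_mem (h hx) hy⟩
    · exact ⟨L, hL, L.add_mem hx (h hy)⟩
  · rintro x ⟨L, hL, hx⟩
    exact ⟨L, hL, L.neg_mem hx⟩
  · rintro x y ⟨L, hL, hy⟩
    exact ⟨L, hL, L.mul_mem_left _ _ hy⟩
  · rintro x y ⟨L, hL, hx⟩
    exact ⟨L, hL, L.mul_mem_right _ _ hx⟩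
  · rw [TwoSidedIdeal.mem_mk']
    rfl

theorem semiprimeClosure_mono {I L : TwoSidedIdeal R} (h : I ≤ L) :
    semiprimeClosure I ≤ semiprimeClosure L :=
  sInf_le_sInf fun _ hP => ⟨hP.1, h.trans hP.2⟩

/-- An ideal that is maximal among those containing no power of `h` is prime. -/
theorem isPrimeIdeal_of_maximal {h : R} {P : TwoSidedIdeal R}
    (hP : Maximal (fun L : TwoSidedIdeal R => ∀ n, 1 ≤ n → nthPow h n ∉ L) P) :
    IsPrimeIdeal P := by
  refine ⟨fun htop => hP.prop 1 le_rfl (htop ▸ TwoSidedIdeal.mem_top R), fun L M hLM => ?_⟩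
  have key : ∀ L : TwoSidedIdeal R, ¬ L ≤ P → ∃ n, 1 ≤ n ∧ nthPow h n ∈ P ⊔ L := by
    intro L hL
    by_contra! H
    exact hL (le_sup_right.trans (hP.le_of_ge H le_sup_left))
  by_contra! H
  obtain ⟨n, hn, hn'⟩ := key L H.1
  obtain ⟨m, hm, hm'⟩ := key M H.2
  obtain ⟨p, hp, l, hl, e1⟩ := TwoSidedIdeal.mem_sup.1 hn'
  obtain ⟨q, hq, r, hr, e2⟩ := TwoSidedIdeal.mem_sup.1 hm'
  refine hP.prop (n + m) (by omega) ?_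
  rw [nthPow_add h hn hm, ← e1, ← e2, mul_add, add_mul p l r]
  exact P.add_mem (P.mul_mem_left _ _ hq) (P.add_mem (P.mul_mem_right _ _ hp)
    (hLM (AddSubgroup.subset_closure ⟨l, hl, r, hr, rfl⟩)))

/-- Every element of the semiprime closure of `I` has a power in `I`. -/
theorem isRadicalOver_semiprimeClosure (I : TwoSidedIdeal R) :
    IsRadicalOver (semiprimeClosure I : Set R) I := by
  intro h hh
  by_contra! H
  obtain ⟨P, hIP, hP⟩ := zorn_le_nonempty₀
    {L : TwoSidedIdeal R | ∀ n, 1 ≤ n → nthPow h n ∉ L} (fun c hcs hc L hL => by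
      obtain ⟨U, hU⟩ := exists_coe_eq_iUnion_of_isChain hc ⟨L, hL⟩
      refine ⟨U, fun n hn hmem => ?_, fun M hM x hx => (hU x).2 ⟨M, hM, hx⟩⟩
      obtain ⟨M, hM, hx⟩ := (hU _).1 hmem
      exact hcs hM n hn hx) I H
  rw [SetLike.mem_coe, semiprimeClosure, TwoSidedIdeal.mem_sInf] at hh
  exact hP.prop 1 le_rfl (hh P ⟨isPrimeIdeal_of_maximal hP, hIP⟩)

end Ring

/-! ### Roots of Dixmier cones. -/

theorem nthPow_eq_nnrpow {a : A} (ha : 0 ≤ a) (n : ℕ) : nthPow a n = a ^ (n : ℝ≥0) := by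
  -- At exponent 0 both sides take the default value 0.
  rcases Nat.eq_zero_or_pos n with rfl | hn
  · simp [nthPow, CFC.nnrpow_zero]
  induction n, hn using Nat.le_induction with
  | base => simp [nthPow, CFC.nnrpow_one a ha]
  | succ n hn ih =>
    rw [nthPow_succ a hn, ih, Nat.cast_add, Nat.cast_one,
      CFC.nnrpow_add (by exact_mod_cast hn) one_pos, CFC.nnrpow_one a ha]

/-- The positive elements with `s`-th power in `C`. -/
def rootCone (C : Set A) (s : ℝ≥0) : Set A := {a | 0 ≤ a ∧ a ^ s ∈ C}

theorem rootCone_rootCone (C : Set A) (s t : ℝ≥0) :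
    rootCone (rootCone C s) t = rootCone C (t * s) := by
  ext a
  simp only [rootCone, Set.mem_ofPred_eq, CFC.nnrpow_nnrpow, CFC.nnrpow_nonneg, true_and]

namespace IsDixmierCone

variable {C : Set A} (hC : IsDixmierCone C)
include hC

theorem rootCone_one : rootCone C 1 = C := by
  ext a
  refine ⟨fun ⟨h0, h⟩ => by rwa [CFC.nnrpow_one a h0] at h, fun h => ⟨hC.nonneg h, ?_⟩⟩
  rwa [CFC.nnrpow_one a (hC.nonneg h)]

/-- a^t = a^{s/2} a^{t-s} a^{s/2} ≤ ‖a^{t-s}‖ a^s. -/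
theorem rootCone_mono {s t : ℝ≥0} (hs : 0 < s) (hst : s ≤ t) : rootCone C s ⊆ rootCone C t := by
  rintro a ⟨h0, ha⟩
  rcases hst.eq_or_lt with rfl | hlt
  · exact ⟨h0, ha⟩
  refine ⟨h0, hC.mem_of_le CFC.nnrpow_nonneg
    (hC.smul_mem ha (norm_nonneg (a ^ (t - s)))) ?_⟩
  have hr : IsSelfAdjoint (a ^ (s / 2)) := .of_nonneg CFC.nnrpow_nonneg
  have hd : 0 < t - s := tsub_pos_of_lt hlt
  have := CStarAlgebra.star_left_conjugate_le_norm_smul (a := a ^ (s / 2)) (b := a ^ (t - s))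
    (.of_nonneg CFC.nnrpow_nonneg)
  rw [hr.star_eq, ← CFC.nnrpow_add (by positivity) hd, ← CFC.nnrpow_add (by positivity)
    (by positivity), ← CFC.nnrpow_add (by positivity) (by positivity), add_halves] at this
  rwa [show s / 2 + (t - s) + s / 2 = t by
    rw [add_right_comm, add_halves, add_tsub_cancel_of_le hst]] at this

/-- Squaring is not operator monotone, so transfer replaces it: with p = √a and q = √b, (qp)⋆(qp) =
pbp ≤ a², while b² = qbq ≤ qaq = (qp)(qp)⋆. -/
theorem mul_self_mem_of_le {a b : A} (hb : 0 ≤ b) (hba : b ≤ a) (ha : a * a ∈ C) :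
    b * b ∈ C := by
  have ha0 := hb.trans hba
  set p := CFC.sqrt a
  set q := CFC.sqrt b
  have hp : star p = p := star_sqrt a
  have hq : star q = q := star_sqrt b
  have hpp : p * p = a := CFC.sqrt_mul_sqrt_self a ha0
  have hqq : q * q = b := CFC.sqrt_mul_sqrt_self b hb
  have h1 : q * p * star (q * p) ∈ C := by
    refine hC.transfer ha ?_
    have := star_left_conjugate_le_conjugate hba p
    calc star (q * p) * (q * p) = star p * b * p := by
          rw [← hqq, star_mul, hq]; simp only [mul_assoc]
      _ ≤ star p * a * p := this
      _ = a * a := by rw [hp, ← hpp]; simp only [mul_assoc]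
  refine hC.mem_of_le (mul_self_nonneg_of_nonneg hb) h1 ?_
  have := star_left_conjugate_le_conjugate hba q
  calc b * b = star q * b * q := by rw [hq, ← hqq]; simp only [mul_assoc]
    _ ≤ star q * a * q := this
    _ = q * p * star (q * p) := by rw [star_mul, hp, hq, ← hpp]; simp only [mul_assoc]

theorem isDixmierCone_rootCone_two : IsDixmierCone (rootCone C 2) := by
  have hiff : ∀ {a : A}, a ∈ rootCone C 2 ↔ 0 ≤ a ∧ a * a ∈ C := fun {a} =>
    and_congr_right fun h => by rw [CFC.nnrpow_two a h]
  refine ⟨hiff.2 ⟨le_rfl, by simpa using hC.zero_mem⟩, fun {a b} ha hb => ?_, fun ha => ha.1,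
    fun {x c} hc h => ?_⟩
  · rw [hiff] at *
    refine ⟨add_nonneg ha.1 hb.1, hC.mem_of_le
      (mul_self_nonneg_of_nonneg (add_nonneg ha.1 hb.1))
      (hC.add_mem (hC.smul_mem ha.2 zero_le_two) (hC.smul_mem hb.2 zero_le_two)) ?_⟩
    have := star_add_mul_add_le a b
    rwa [star_add, (IsSelfAdjoint.of_nonneg ha.1).star_eq,
      (IsSelfAdjoint.of_nonneg hb.1).star_eq] at this
  · rw [hiff] at *
    refine ⟨mul_star_self_nonneg x, ?_⟩
    have hb := star_mul_self_nonneg x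
    have hbb := hC.mul_self_mem_of_le hb h hc.2
    have hq : star (CFC.sqrt (star x * x)) = CFC.sqrt (star x * x) := star_sqrt _
    have hqq := CFC.sqrt_mul_sqrt_self _ hb
    set q := CFC.sqrt (star x * x)
    have h1 : star (x * q) * (x * q) = star x * x * (star x * x) := by
      calc star (x * q) * (x * q) = q * (star x * x) * q := by
            rw [star_mul, hq]; simp only [mul_assoc]
        _ = _ := by rw [← hqq]; simp only [mul_assoc]
    have h2 : x * q * star (x * q) = x * star x * (x * star x) := by
      calc x * q * star (x * q) = x * (q * q) * star x := by
            rw [star_mul, hq]; simp only [mul_assoc]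
        _ = _ := by rw [hqq]; simp only [mul_assoc]
    rw [← h2]
    exact hC.swap (by rwa [h1])

omit hC in
theorem rootCone_two_pow_succ (C : Set A) (k : ℕ) :
    rootCone C ((2 ^ (k + 1) : ℕ) : ℝ≥0) = rootCone (rootCone C 2) ((2 ^ k : ℕ) : ℝ≥0) := by
  rw [rootCone_rootCone, pow_succ]
  push_cast
  rfl

theorem isDixmierCone_rootCone_two_pow (k : ℕ) :
    IsDixmierCone (rootCone C ((2 ^ k : ℕ) : ℝ≥0)) := by
  induction k generalizing C with
  | zero => simpa [hC.rootCone_one] using hC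
  | succ k ih =>
    rw [rootCone_two_pow_succ]
    exact ih hC.isDixmierCone_rootCone_two

/-- By Löwner–Heinz, b^{n/2^n} ≤ a^{n/2^n}, and the cone of 2^n-th roots is hereditary. -/
theorem nnrpow_mem_of_le {n : ℕ} {a b : A} (hba : b ≤ a)
    (ha : a ^ (n : ℝ≥0) ∈ C) : b ^ (n : ℝ≥0) ∈ C := by
  have h2 : ((2 ^ n : ℕ) : ℝ≥0) ≠ 0 := by positivity
  have hr : (n : ℝ≥0) / ((2 ^ n : ℕ) : ℝ≥0) ∈ Set.Icc (0 : ℝ≥0) 1 :=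
    ⟨zero_le, div_le_one_of_le₀ (by exact_mod_cast Nat.lt_two_pow_self.le) (zero_le)⟩
  have hle := CFC.nnrpow_le_nnrpow hr hba
  have := ((hC.isDixmierCone_rootCone_two_pow n).mem_of_le CFC.nnrpow_nonneg
    ⟨CFC.nnrpow_nonneg, by rwa [CFC.nnrpow_nnrpow, div_mul_cancel₀ _ h2]⟩ hle).2
  rwa [CFC.nnrpow_nnrpow, div_mul_cancel₀ _ h2] at this

/-- The positive `n`-th roots of the elements of a Dixmier cone form a Dixmier cone. -/
theorem isDixmierCone_rootCone {n : ℕ} (hn : 1 ≤ n) : IsDixmierCone (rootCone C n) := by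
  have hn0 : (n : ℝ≥0) ≠ 0 := by positivity
  have hnpos : 0 < (n : ℝ≥0) := by positivity
  refine ⟨⟨le_rfl, by simpa using hC.zero_mem⟩, fun {a b} ha hb => ?_, fun ha => ha.1,
    fun {x c} hc h => ⟨mul_star_self_nonneg x, ?_⟩⟩
  · have h0 : 0 ≤ a + b := add_nonneg ha.1 hb.1
    refine ⟨h0, ?_⟩
    -- By Löwner–Heinz e dominates both a and b, so a + b ≤ 2e, while eⁿ = aⁿ + bⁿ ∈ C.
    set e := (a ^ (n : ℝ≥0) + b ^ (n : ℝ≥0)) ^ ((n : ℝ≥0)⁻¹) with he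
    have hd : 0 ≤ a ^ (n : ℝ≥0) + b ^ (n : ℝ≥0) :=
      add_nonneg CFC.nnrpow_nonneg CFC.nnrpow_nonneg
    have he0 : 0 ≤ e := CFC.nnrpow_nonneg
    have hinv : (n : ℝ≥0)⁻¹ ∈ Set.Icc (0 : ℝ≥0) 1 :=
      ⟨zero_le, inv_le_one_of_one_le₀ (by exact_mod_cast hn)⟩
    have hae : a ≤ e := by
      have := CFC.nnrpow_le_nnrpow hinv (le_add_of_nonneg_right CFC.nnrpow_nonneg :
        a ^ (n : ℝ≥0) ≤ a ^ (n : ℝ≥0) + b ^ (n : ℝ≥0))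
      rwa [CFC.nnrpow_nnrpow_inv a hn0 ha.1] at this
    have hbe : b ≤ e := by
      have := CFC.nnrpow_le_nnrpow hinv (le_add_of_nonneg_left CFC.nnrpow_nonneg :
        b ^ (n : ℝ≥0) ≤ a ^ (n : ℝ≥0) + b ^ (n : ℝ≥0))
      rwa [CFC.nnrpow_nnrpow_inv b hn0 hb.1] at this
    have hen : e ^ (n : ℝ≥0) ∈ C := by
      rw [he, CFC.nnrpow_inv_nnrpow _ hn0 hd]
      exact hC.add_mem ha.2 hb.2
    refine hC.nnrpow_mem_of_le (add_le_add hae hbe) ?_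
    have key : ∀ m : ℕ, 1 ≤ m → ∃ t : ℝ, 0 ≤ t ∧ nthPow (e + e) m = t • nthPow e m := by
      intro m hm
      induction m, hm using Nat.le_induction with
      | base => exact ⟨2, zero_le_two, (two_smul ℝ e).symm⟩
      | succ m hm ih =>
        obtain ⟨t, ht, h⟩ := ih
        refine ⟨t * 2, by positivity, ?_⟩
        rw [nthPow_succ _ hm, nthPow_succ _ hm, h, ← two_smul ℝ e, smul_mul_smul_comm]
    obtain ⟨t, ht, h⟩ := key n hn
    rw [← nthPow_eq_nnrpow (add_nonneg he0 he0), h, nthPow_eq_nnrpow he0]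
    exact hC.smul_mem hen ht
  · have hb := star_mul_self_nonneg x
    have hmem := hC.nnrpow_mem_of_le h hc.2
    -- The case n = 1 is separate: below, p = (x⋆x)^{(n-1)/2} needs a positive exponent, since the
    -- zeroth power is 0.
    rcases hn.eq_or_lt with rfl | hlt
    · rw [Nat.cast_one] at hmem ⊢
      rw [CFC.nnrpow_one _ hb] at hmem
      rw [CFC.nnrpow_one _ (mul_star_self_nonneg x)]
      exact hC.swap hmem
    obtain ⟨m, rfl⟩ := Nat.exists_eq_add_of_lt hlt
    have hm : 1 ≤ m + 1 := by omega
    have hmpos : 0 < ((m + 1 : ℕ) : ℝ≥0) / 2 := by positivity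
    have hswap : ∀ m : ℕ, 1 ≤ m →
        x * nthPow (star x * x) m * star x = nthPow (x * star x) (m + 1) := by
      intro m hm
      induction m, hm using Nat.le_induction with
      | base => simp [nthPow, mul_assoc]
      | succ m hm ih =>
        rw [nthPow_succ _ (by omega : 1 ≤ m + 1), ← ih, nthPow_succ _ hm]
        simp only [mul_assoc]
    set p := (star x * x) ^ (((m + 1 : ℕ) : ℝ≥0) / 2) with hp
    have hps : star p = p := (IsSelfAdjoint.of_nonneg CFC.nnrpow_nonneg).star_eq
    have hpp : p * p = (star x * x) ^ ((m + 1 : ℕ) : ℝ≥0) := by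
      rw [hp, ← CFC.nnrpow_add hmpos hmpos, add_halves]
    have h1 : star (x * p) * (x * p) = (star x * x) ^ ((1 + m + 1 : ℕ) : ℝ≥0) := by
      have e : star (x * p) * (x * p) = p * (star x * x) ^ (1 : ℝ≥0) * p := by
        rw [star_mul, hps, CFC.nnrpow_one _ hb]; simp only [mul_assoc]
      rw [e, hp, ← CFC.nnrpow_add hmpos one_pos, ← CFC.nnrpow_add (by positivity) hmpos]
      congr 1
      push_cast
      rw [add_right_comm, add_halves]
      ring
    have h2 : x * p * star (x * p) = (x * star x) ^ ((1 + m + 1 : ℕ) : ℝ≥0) := by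
      have e : x * p * star (x * p) = x * (p * p) * star x := by
        rw [star_mul, hps]; simp only [mul_assoc]
      rw [e, hpp, ← nthPow_eq_nnrpow hb, hswap _ hm,
        ← nthPow_eq_nnrpow (mul_star_self_nonneg x), add_assoc 1 m 1, add_comm 1 (m + 1)]
    rw [← h2]
    exact hC.swap (by rwa [h1])

theorem mul_mem_span_of_rootCone_two {x y : A} (hx : x ∈ Submodule.span ℂ (rootCone C 2))
    (hy : y ∈ Submodule.span ℂ (rootCone C 2)) : x * y ∈ Submodule.span ℂ C := by
  have h : Submodule.span ℂ (rootCone C 2) ≤ hC.half := Submodule.span_le.2 fun a ha => by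
    rw [SetLike.mem_coe, mem_half, (IsSelfAdjoint.of_nonneg ha.1).star_eq, ← CFC.nnrpow_two a ha.1]
    exact ha.2
  exact hC.mul_mem_span (h hx) (h hy)

theorem nthPow_two_pow_mem_span (k : ℕ) {x : A}
    (hx : x ∈ Submodule.span ℂ (rootCone C ((2 ^ k : ℕ) : ℝ≥0))) :
    nthPow x (2 ^ k) ∈ Submodule.span ℂ C := by
  induction k generalizing C with
  | zero => simpa [hC.rootCone_one, nthPow] using hx
  | succ k ih =>
    rw [rootCone_two_pow_succ] at hx
    have := ih hC.isDixmierCone_rootCone_two hx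
    rw [pow_succ, mul_two, nthPow_add x Nat.one_le_two_pow Nat.one_le_two_pow]
    exact hC.mul_mem_span_of_rootCone_two this this

/-- The ideal spanned by the square roots has its square inside the span of `C`, hence in `P`;
primeness removes one square root at a time. -/
theorem span_rootCone_two_pow_subset {P : TwoSidedIdeal A} (hP : IsPrimeIdeal P)
    (h : ∀ x ∈ Submodule.span ℂ C, x ∈ P) (k : ℕ) {x : A}
    (hx : x ∈ Submodule.span ℂ (rootCone C ((2 ^ k : ℕ) : ℝ≥0))) : x ∈ P := by
  induction k generalizing C with
  | zero => exact h x (by simpa [hC.rootCone_one] using hx)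
  | succ k ih =>
    rw [rootCone_two_pow_succ] at hx
    have h2 := hC.isDixmierCone_rootCone_two
    refine ih h2 (fun y hy => ?_) hx
    have hle : h2.toIdeal ≤ P := by
      refine or_self_iff.1 (hP.2 h2.toIdeal h2.toIdeal fun z hz => ?_)
      have : idealMul h2.toIdeal h2.toIdeal ≤ AddSubgroup.closure (P : Set A) := by
        refine (AddSubgroup.closure_le _).2 ?_
        rintro _ ⟨a, ha, b, hb, rfl⟩
        exact AddSubgroup.subset_closure (h _ (hC.mul_mem_span_of_rootCone_two
          (h2.mem_toIdeal.1 ha) (h2.mem_toIdeal.1 hb)))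
      refine AddSubgroup.closure_induction (p := fun y _ => y ∈ P) (fun y hy => hy) P.zero_mem
        (fun a b _ _ ha hb => P.add_mem ha hb) (fun a _ ha => P.neg_mem ha) (this hz)
    exact hle (h2.mem_toIdeal.2 hy)

/-- For d = (x⋆x)^{1/4}, x is a left multiple of d and d^{4n} = (x⋆x)^n ∈ C. -/
theorem mem_span_rootCone_of_nthPow_mem {n : ℕ} (hn : 1 ≤ n) {x : A}
    (hx : nthPow (star x * x) n ∈ C) :
    x ∈ Submodule.span ℂ (rootCone C ((4 * n : ℕ) : ℝ≥0)) := by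
  have hb := star_mul_self_nonneg x
  have hD := hC.isDixmierCone_rootCone (n := 4 * n) (by omega)
  set d := (star x * x) ^ (1 / 4 : ℝ≥0) with hd
  have hd0 : 0 ≤ d := CFC.nnrpow_nonneg
  have hd4 : d * d * (d * d) = star x * x := by
    rw [hd, ← CFC.nnrpow_add (by positivity) (by positivity),
      ← CFC.nnrpow_add (by positivity) (by positivity)]
    conv_rhs => rw [← CFC.nnrpow_one _ hb]
    congr 1
    norm_num
  obtain ⟨u, hu⟩ := exists_eq_mul_of_le hd0 hd4.ge
  rw [hu]
  refine hD.mul_span_mem u (Submodule.subset_span ⟨hd0, ?_⟩)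
  rw [nthPow_eq_nnrpow hb] at hx
  rw [hd, CFC.nnrpow_nnrpow]
  convert hx using 2
  push_cast
  rw [← mul_assoc]
  norm_num

end IsDixmierCone

/-! ### The semiprime closure in terms of roots. -/

theorem dixmierPow_one_div {L : TwoSidedIdeal A} {n : ℕ} (hn : 1 ≤ n) :
    dixmierPow L (1 / (n : ℝ≥0)) = Submodule.span ℂ (rootCone (positivePart L) n) := by
  have hn0 : (n : ℝ≥0) ≠ 0 := by positivity
  rw [dixmierPow, one_div]
  congr 1
  ext b
  constructor
  · rintro ⟨a, ha, rfl⟩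
    exact ⟨CFC.nnrpow_nonneg, by rwa [CFC.nnrpow_inv_nnrpow a hn0 ha.2]⟩
  · rintro ⟨h0, hb⟩
    exact ⟨b ^ (n : ℝ≥0), hb, (CFC.nnrpow_nnrpow_inv b hn0 h0).symm⟩

theorem mem_semiprimeClosure_of_mem_span {I L : TwoSidedIdeal A} (hL : IsDixmier L) (hLI : L ≤ I)
    {n : ℕ} (hn : 1 ≤ n) {x : A} (hx : x ∈ Submodule.span ℂ (rootCone (positivePart L) n)) :
    x ∈ semiprimeClosure I := by
  rw [semiprimeClosure, TwoSidedIdeal.mem_sInf]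
  intro P hP
  have hC := hL.isDixmierCone
  refine hC.span_rootCone_two_pow_subset hP.1 (fun y hy => hP.2 (hLI (hL.mem_iff.2 hy))) n
    (Submodule.span_mono (hC.rootCone_mono (by positivity) ?_) hx)
  exact_mod_cast Nat.lt_two_pow_self.le

/-- The inner factor 4 brings the power of x⋆x into the interior; the outer one comes from dividing
x by (x⋆x)^{1/4}. -/
theorem mem_span_rootCone_dixmierInterior {I : TwoSidedIdeal A} {n : ℕ} (hn : 1 ≤ n) {x : A}
    (hx : nthPow (star x * x) n ∈ I) :
    x ∈ Submodule.span ℂ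
      (rootCone (positivePart (dixmierInterior I)) ((4 * (n * 4) : ℕ) : ℝ≥0)) := by
  have hb := star_mul_self_nonneg x
  have h0 : 0 ≤ nthPow (star x * x) n := by
    rw [nthPow_eq_nnrpow hb]; exact CFC.nnrpow_nonneg
  have h4 := fourth_power_mem_dixmierInterior (I := I) ⟨hx, h0⟩
  have e : nthPow (star x * x) (n * 4) = nthPow (star x * x) n * nthPow (star x * x) n *
      (nthPow (star x * x) n * nthPow (star x * x) n) := by
    rw [nthPow_mul _ hn (by norm_num)]; simp [nthPow, mul_assoc]
  refine (isDixmier_dixmierInterior I).isDixmierCone.mem_span_rootCone_of_nthPow_mem (by omega)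
    ⟨e ▸ h4, ?_⟩
  rw [nthPow_eq_nnrpow hb]
  exact CFC.nnrpow_nonneg

theorem mem_semiprimeClosure_iff_nthPow {I : TwoSidedIdeal A} {x : A} :
    x ∈ semiprimeClosure I ↔ ∃ n : ℕ, 1 ≤ n ∧ nthPow (star x * x) n ∈ positivePart I := by
  constructor
  · intro hx
    obtain ⟨n, hn, h⟩ := isRadicalOver_semiprimeClosure I (star x * x)
      (TwoSidedIdeal.mul_mem_left _ _ _ hx)
    refine ⟨n, hn, h, ?_⟩
    rw [nthPow_eq_nnrpow (star_mul_self_nonneg x)]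
    exact CFC.nnrpow_nonneg
  · rintro ⟨n, hn, h, -⟩
    exact mem_semiprimeClosure_of_mem_span (isDixmier_dixmierInterior I) (dixmierInterior_le I)
      (by omega) (mem_span_rootCone_dixmierInterior hn h)

theorem mem_semiprimeClosure_iff_dixmierPow {I : TwoSidedIdeal A} {x : A} :
    x ∈ semiprimeClosure I ↔
      ∃ n : ℕ, 1 ≤ n ∧ x ∈ dixmierPow (dixmierInterior I) (1 / (n : ℝ≥0)) := by
  have hJ := isDixmier_dixmierInterior I
  constructor
  · intro hx
    obtain ⟨n, hn, h, -⟩ := mem_semiprimeClosure_iff_nthPow.1 hx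
    refine ⟨4 * (n * 4), by omega, ?_⟩
    rw [dixmierPow_one_div (by omega)]
    exact mem_span_rootCone_dixmierInterior hn h
  · rintro ⟨n, hn, h⟩
    rw [dixmierPow_one_div hn] at h
    exact mem_semiprimeClosure_of_mem_span hJ (dixmierInterior_le I) hn h

theorem star_mem_semiprimeClosure {I : TwoSidedIdeal A} {x : A} (hx : x ∈ semiprimeClosure I) :
    star x ∈ semiprimeClosure I := by
  have hJ := isDixmier_dixmierInterior I
  obtain ⟨n, hn, h⟩ := mem_semiprimeClosure_iff_dixmierPow.1 hx
  refine mem_semiprimeClosure_iff_dixmierPow.2 ⟨n, hn, ?_⟩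
  rw [dixmierPow_one_div hn] at h ⊢
  have hD := hJ.isDixmierCone.isDixmierCone_rootCone hn
  exact hD.mem_toIdeal.1 (hD.isDixmier_toIdeal.star_mem (hD.mem_toIdeal.2 h))

theorem semiprimeClosure_dixmierInterior (I : TwoSidedIdeal A) :
    semiprimeClosure (dixmierInterior I) = semiprimeClosure I := by
  ext x
  rw [mem_semiprimeClosure_iff_dixmierPow, mem_semiprimeClosure_iff_dixmierPow,
    dixmierInterior_eq_self (isDixmier_dixmierInterior I)]

theorem dixmierClosure_le_semiprimeClosure (I : TwoSidedIdeal A) :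
    dixmierClosure I ≤ semiprimeClosure I := by
  have hJ := isDixmier_dixmierInterior I
  have hD := hJ.isDixmierCone.isDixmierCone_rootCone (n := 4 * (1 * 4)) (by norm_num)
  refine (dixmierClosure_le hD.isDixmier_toIdeal fun x hx => ?_).trans fun x hx => ?_
  · exact hD.mem_toIdeal.2 (mem_span_rootCone_dixmierInterior le_rfl (I.mul_mem_left _ _ hx))
  · exact mem_semiprimeClosure_of_mem_span hJ (dixmierInterior_le I) (by norm_num)
      (hD.mem_toIdeal.1 hx)

theorem semiprimeClosure_dixmierClosure (I : TwoSidedIdeal A) :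
    semiprimeClosure (dixmierClosure I) = semiprimeClosure I := by
  refine le_antisymm (sInf_le_sInf fun P hP => ⟨hP.1, ?_⟩)
    (semiprimeClosure_mono (le_dixmierClosure I))
  exact (dixmierClosure_le_semiprimeClosure I).trans (sInf_le hP)

end CStarIdeal

theorem theorem4p8 {A : Type*} [NonUnitalCStarAlgebra A] [PartialOrder A] [StarOrderedRing A]
    (I J K : TwoSidedIdeal A)
    (hJ : J = CStarIdeal.dixmierInterior I) (hK : K = CStarIdeal.dixmierClosure I) :
    (CStarIdeal.IsDixmier J ∧ CStarIdeal.IsDixmier K) ∧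
    CStarIdeal.semiprimeClosure I = CStarIdeal.semiprimeClosure J ∧
    CStarIdeal.semiprimeClosure I = CStarIdeal.semiprimeClosure K ∧
    (CStarIdeal.semiprimeClosure I : Set A) =
      ⋃ (n : ℕ) (_ : 1 ≤ n), (CStarIdeal.dixmierPow J (1 / (n : ℝ≥0)) : Set A) ∧
    (CStarIdeal.semiprimeClosure I : Set A) =
      ⋃ (n : ℕ) (_ : 1 ≤ n), (CStarIdeal.dixmierPow K (1 / (n : ℝ≥0)) : Set A) ∧
    (CStarIdeal.semiprimeClosure I : Set A) =
      {x : A | ∃ n : ℕ, 1 ≤ n ∧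
        CStarIdeal.nthPow (star x * x) n ∈ CStarIdeal.positivePart I} ∧
    (CStarIdeal.semiprimeClosure I : Set A) =
      {x : A | ∃ n : ℕ, 1 ≤ n ∧
        CStarIdeal.nthPow (x * star x) n ∈ CStarIdeal.positivePart I} ∧
    -- the sets `J ^ (1 / n)` form an increasing sequence of two-sided ideals, radical over `I`
    (∀ n : ℕ, 1 ≤ n →
      (∃ L : TwoSidedIdeal A, (L : Set A) = CStarIdeal.dixmierPow J (1 / (n : ℝ≥0))) ∧
      CStarIdeal.dixmierPow J (1 / (n : ℝ≥0)) ≤ CStarIdeal.dixmierPow J (1 / ((n + 1 : ℕ) : ℝ≥0)) ∧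
      CStarIdeal.IsRadicalOver (CStarIdeal.dixmierPow J (1 / (n : ℝ≥0)) : Set A) I) := by
  subst hJ hK
  have hJ := CStarIdeal.isDixmier_dixmierInterior I
  have hK := CStarIdeal.isDixmier_dixmierClosure I
  refine ⟨⟨hJ, hK⟩, (CStarIdeal.semiprimeClosure_dixmierInterior I).symm,
    (CStarIdeal.semiprimeClosure_dixmierClosure I).symm, ?_, ?_, ?_, ?_, fun n hn => ?_⟩
  · ext x
    simpa using CStarIdeal.mem_semiprimeClosure_iff_dixmierPow (I := I) (x := x)
  · ext x
    -- The closure is Dixmier, hence its own interior, and has the same semiprime closure as `I`.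
    have := CStarIdeal.mem_semiprimeClosure_iff_dixmierPow
      (I := CStarIdeal.dixmierClosure I) (x := x)
    rw [CStarIdeal.semiprimeClosure_dixmierClosure, CStarIdeal.dixmierInterior_eq_self hK] at this
    simpa using this
  · ext x
    exact CStarIdeal.mem_semiprimeClosure_iff_nthPow
  · ext x
    have := CStarIdeal.mem_semiprimeClosure_iff_nthPow (I := I) (x := star x)
    rw [star_star] at this
    refine Iff.trans ⟨fun h => CStarIdeal.star_mem_semiprimeClosure h, fun h => ?_⟩ this
    simpa using CStarIdeal.star_mem_semiprimeClosure h
  · have hC := hJ.isDixmierCone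
    have hD := hC.isDixmierCone_rootCone hn
    refine ⟨⟨hD.toIdeal, ?_⟩, ?_, fun x hx => ?_⟩
    · rw [CStarIdeal.dixmierPow_one_div hn, hD.coe_toIdeal]
    · rw [CStarIdeal.dixmierPow_one_div hn, CStarIdeal.dixmierPow_one_div (by omega)]
      exact Submodule.span_mono (hC.rootCone_mono (by positivity) (by simp))
    · rw [CStarIdeal.dixmierPow_one_div hn] at hx
      -- Enlarging n to 2^n allows repeated squaring down to the interior.
      have h2 : (n : ℝ≥0) ≤ ((2 ^ n : ℕ) : ℝ≥0) := by exact_mod_cast Nat.lt_two_pow_self.le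
      have := hC.nthPow_two_pow_mem_span n
        (Submodule.span_mono (hC.rootCone_mono (by positivity) h2) hx)
      exact ⟨2 ^ n, Nat.one_le_two_pow,
        CStarIdeal.dixmierInterior_le I (hJ.mem_iff.2 this)⟩
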